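/- Let $\mathfrak C$ be a (one-sorted, nonempty) monster model of a first-order theory in a language $L$: for some cardinal $\kappa>\aleph_0+|L|$, $\mathfrak C$ is $\kappa$-saturated and strongly $\kappa$-homogeneous; a subset is small if it has fewer than $\kappa$ elements. Let $G$ be a group $\emptyset$-definable in $\mathfrak C$ by a formula $G(x)$ in one variable, let $A\subseteq\mathfrak C$ be small, and let $p\in S_1(\mathfrak C)$ be a global type containing $G(x)$. A sequence $(a_i)_{i<\omega}$ is a Morley sequence in $p$ over $B$ if $a_i\models p|_{B\cup\{a_j:j<i\}}$ for all $i$. The type $p$ is generically stable if for some small $A'$ it is $\mathrm{Aut}(\mathfrak C/A')$-invariant and for every formula $\varphi(x;y)$ there is $m<\omega$ such that for every Morley sequence $(a_i)_{i<\omega}$ in $p$ over $A'$ and every tuple $b$ from $\mathfrak C$, fewer than $m$ of the $a_i$ satisfy $\varphi(x;b)$ or fewer than $m$ of the $a_i$ satisfy $\neg\varphi(x;b)$; it is generically stable over $A$ if it is moreover $A$-invariant. For an $A$-invariant $p$, $p^{(\omega)}$ denotes the type over $\mathfrak C$ of a Morley sequence over $\mathfrak C$, taken in an elementary extension of $\mathfrak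 C$, in the $A$-invariant extension of $p$ to that elementary extension (the extension contains $\varphi(x;d)$ if and only if $d$ has the same type over $A$ as some tuple $c$ of $\mathfrak C$ with $\varphi(x;c)\in p$). Assume that $p$ is generically stable over $A$. (i) Let $k<\omega$ and let $H(x,\bar z;y)$, $|\bar z|=k$, be a formula over $A$ such that $H(G,c;g)=\{x\in G:\ \models H(x,c;g)\}$ is a subgroup of $G$ for all $g\in G$, $c\in G^k$. Then there is $n<\omega$ such that for all $c\in G^k$, all $(g_0,g_1,\dots)\models p^{(\omega)}|_{Ac}$ and all $i_1<\dots<i_n<\omega$, \[\bigcap_{i<\omega}H(G,c;g_i)=H(G,c;g_{i_1})\cap\dots\cap H(G,c;g_{i_n}).\] (ii) Let $k<\omega$ and let $H(x,y_1,\dots,y_k)$ be a formula over $A$ such that $H(G,h_1,\dots,h_k)=\{x\in G:\ \models H(x,h_1,\dots,h_k)\}$ is a subgroup of $G$ for all $h_1,\dots,h_k\in G$. Then for every $(g_0,g_1,\dots)\models p^{(\omega)}|_A$ there is $n<\omega$ such that \[\bigcap_{i_1<\dots<i_k<\omega}H(G,g_{i_1},\dots,g_{i_k})=\bigcap_{i_1<\dots<i_k<n}H(G,g_{i_1},\dots,g_{i_k})=\bigcap_{\substack{i_1<\dots<i_k\\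 i_1,\dots,i_k\in S}}H(G,g_{i_1},\dots,g_{i_k})\] for every set $S\subseteq\omega$ of cardinality $n$. (Here an empty intersection is $G$.) -/

import Mathlib

open FirstOrder FirstOrder.Language

universe u v w

namespace StableChain

variable {L : FirstOrder.Language.{u, v}}

/-! ### Monster models -/

/-- `M` is `κ`-saturated: every complete 1-type over a set of fewer than `κ` parameters
is realized in `M`. -/
def IsSaturated (L : FirstOrder.Language.{u, v}) (M : Type w) [L.Structure M] [Nonempty M]
    (κ : Cardinal.{w}) : Prop :=
  ∀ B : Set M, Cardinal.mk B < κ →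
    ∀ q : (L[[B]].completeTheory M).CompleteType (Fin 1),
      q ∈ (L[[B]].completeTheory M).realizedTypes M (Fin 1)

/-- `M` is strongly `κ`-homogeneous: every partial elementary map whose domain has fewer than `κ`
elements extends to an automorphism of `M`. -/
def IsStronglyHomogeneous (L : FirstOrder.Language.{u, v}) (M : Type w) [L.Structure M]
    (κ : Cardinal.{w}) : Prop :=
  ∀ B : Set M, Cardinal.mk B < κ → ∀ f : B → M,
    (∀ φ : L.Formula B, φ.Realize (fun b : B => (b : M)) ↔ φ.Realize f) →
      ∃ σ : M ≃[L] M, ∀ b : B, σ (b : M) = f b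

/-- `M` is a monster model with degree of saturation `κ`. A subset of `M` is small if it has
fewer than `κ` elements. -/
structure IsMonster (L : FirstOrder.Language.{u, v}) (M : Type w) [L.Structure M] [Nonempty M]
    (κ : Cardinal.{w}) : Prop where
  aleph0_lt : Cardinal.aleph0 < κ
  card_lt : Cardinal.lift.{w} L.card < Cardinal.lift.{max u v} κ
  saturated : IsSaturated L M κ
  homogeneous : IsStronglyHomogeneous L M κ

/-! ### Types -/

/-- The tuples `s` and `t` of `M` have the same type over `A`. -/
def SameType {M : Type w} [L.Structure M] {ι : Type*} (A : Set M) (s t : ι → M) : Prop :=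
  ∀ φ : L[[A]].Formula ι, φ.Realize s ↔ φ.Realize t

/-- The space `S₁(M)` of complete 1-types over `M`. -/
abbrev GlobalType (L : FirstOrder.Language.{u, v}) (M : Type w) [L.Structure M] :=
  (L.elementaryDiagram M).CompleteType (Fin 1)

/-- The formula `φ(x; c)` with parameters in `M`, for a formula `φ(x; y)` without parameters
and a finite tuple `c` of elements of `M`. -/
def withParams {M : Type w} {n : ℕ} (φ : L.Formula (Fin 1 ⊕ Fin n)) (c : Fin n → M) :
    L[[M]].Formula (Fin 1) :=
  ((L.lhomWithConstants M).onFormula φ).subst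
    (Sum.elim (fun i => Term.var i) (fun j => (L.con (c j)).term))

/-- A set of formulas `φ(x; c)` in one variable with parameters in `M`, where `φ(x; y)` is a
formula without parameters and `c` a finite tuple of `M`. -/
abbrev FormulaSet (L : FirstOrder.Language.{u, v}) (M : Type w) :=
  ∀ n : ℕ, L.Formula (Fin 1 ⊕ Fin n) → (Fin n → M) → Prop

/-- The formulas `φ(x; c)` that belong to the global type `p`. -/
def formulasOf {M : Type w} [L.Structure M] (p : GlobalType L M) : FormulaSet L M :=
  fun _ φ c => Formula.equivSentence (withParams φ c) ∈ p

/-- `(a i : i < ω)` is a Morley sequence over `B` in the type with formulas `P`: each `a i`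
realizes the restriction of the type to `B ∪ {a j : j < i}`. -/
def IsMorleySeq {M : Type w} [L.Structure M] (P : FormulaSet L M) (B : Set M) (a : ℕ → M) : Prop :=
  ∀ i n, ∀ φ : L.Formula (Fin 1 ⊕ Fin n), ∀ c : Fin n → M,
    (∀ k, c k ∈ B ∪ a '' Set.Iio i) →
      (P n φ c ↔ φ.Realize (Sum.elim (fun _ => a i) c))

/-- `p` is `A`-invariant: it is fixed by every automorphism of `M` that fixes `A` pointwise. -/
def IsInvariant {M : Type w} [L.Structure M] (p : GlobalType L M) (A : Set M) : Prop :=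
  ∀ σ : M ≃[L] M, (∀ a ∈ A, σ a = a) →
    ∀ n, ∀ φ : L.Formula (Fin 1 ⊕ Fin n), ∀ c : Fin n → M,
      formulasOf p n φ c ↔ formulasOf p n φ (fun k => σ (c k))

/-- `p` is generically stable: for some small `A`, it is `A`-invariant, and for each formula
`φ(x; y)` there is `m` such that for every Morley sequence in `p` over `A` and all parameters `b`,
fewer than `m` terms of the sequence satisfy `φ(x; b)` or fewer than `m` satisfy its negation. -/
def IsGenericallyStable {M : Type w} [L.Structure M] (κ : Cardinal.{w})
    (p : GlobalType L M) : Prop :=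
  ∃ A : Set M, Cardinal.mk A < κ ∧ IsInvariant p A ∧
    ∀ n, ∀ φ : L.Formula (Fin 1 ⊕ Fin n), ∃ m : ℕ,
      ∀ a : ℕ → M, IsMorleySeq (formulasOf p) A a → ∀ b : Fin n → M,
        {i | φ.Realize (Sum.elim (fun _ => a i) b)}.encard < m ∨
        {i | ¬ φ.Realize (Sum.elim (fun _ => a i) b)}.encard < m

/-- `p` is generically stable over `A`. -/
def IsGenericallyStableOver {M : Type w} [L.Structure M] (κ : Cardinal.{w})
    (p : GlobalType L M) (A : Set M) : Prop :=
  IsInvariant p A ∧ IsGenericallyStable κ p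

/-- The `A`-invariant extension of `p` to an elementary extension `j : M → N`, given by the
generalized defining scheme of `p`: it contains `φ(x; d)` iff `d` has the same type over `A`
as some tuple `c` of `M` with `φ(x; c) ∈ p`. -/
def extension {M N : Type w} [L.Structure M] [L.Structure N] (p : GlobalType L M) (A : Set M)
    (j : M ↪ₑ[L] N) : FormulaSet L N :=
  fun n φ d => ∃ c : Fin n → M, SameType (L := L) (j '' A) (fun k => j (c k)) d ∧ formulasOf p n φ c

/-- The sequence `g` of `M` realizes `p^(ω)` restricted to `B`, where `p^(ω)` is the type over `M`
of a Morley sequence in `p`, that is, of a Morley sequence over `M` in the `A`-invariant extension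
of `p` to a larger model. -/
def RealizesPower {M : Type w} [L.Structure M] (p : GlobalType L M) (A B : Set M)
    (g : ℕ → M) : Prop :=
  ∃ (N : Type w) (_ : L.Structure N) (j : M ↪ₑ[L] N) (h : ℕ → N),
    IsMorleySeq (extension p A j) (Set.range j) h ∧
      SameType (L := L) (j '' B) (fun i => j (g i)) h

/-! ### Definable groups -/

/-- A group `∅`-definable in `M`: its universe is the set of solutions of a formula `G(x)` without
parameters, and the graph of its multiplication is defined by a formula without parameters. -/
structure DefinableGroup (L : FirstOrder.Language.{u, v}) (M : Type w) [L.Structure M] where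
  formula : L.Formula (Fin 1)
  mulFormula : L.Formula (Fin 3)
  group : Group {x : M // formula.Realize (fun _ => x)}
  realize_mul : ∀ a b c : {x : M // formula.Realize (fun _ => x)},
    mulFormula.Realize ![(a : M), (b : M), (c : M)] ↔ a * b = c

namespace DefinableGroup

variable {M : Type w} [L.Structure M]

/-- The universe of the definable group. -/
abbrev Carrier (G : DefinableGroup L M) : Type w := {x : M // G.formula.Realize (fun _ => x)}

instance (G : DefinableGroup L M) : Group G.Carrier := G.group

/-- The formula `G(x)` belongs to `p`. -/
def MemType (G : DefinableGroup L M) (p : GlobalType L M) : Prop :=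
  Formula.equivSentence ((L.lhomWithConstants M).onFormula G.formula) ∈ p

/-- The set `H(G, t) = {x ∈ G : M ⊨ H(x, t)}`. -/
def fiber (G : DefinableGroup L M) {A : Set M} {ι : Type*} (H : L[[A]].Formula (Fin 1 ⊕ ι))
    (t : ι → M) : Set G.Carrier :=
  {x | H.Realize (Sum.elim (fun _ => (x : M)) t)}

/-- `H(x, t)` defines a family of groups: `H(G, t)` is a subgroup of `G` for every tuple `t`
from `G`. -/
def DefinesSubgroups (G : DefinableGroup L M) {A : Set M} {ι : Type*}
    (H : L[[A]].Formula (Fin 1 ⊕ ι)) : Prop :=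
  ∀ t : ι → G.Carrier, ∃ K : Subgroup G.Carrier, (K : Set G.Carrier) = G.fiber H (fun k => (t k : M))

end DefinableGroup

end StableChain

/-!
Both chain conditions rest on an exchange property for the subgroups `K t` that a formula `H`
defines at increasing tuples `t` of indices of a realization `g` of `p^(ω)`: if one entry of `t` is
allowed to take `N` other values between its neighbours, then `K t` contains the intersection of
the `N` subgroups obtained (`IsGenericallyStableOver.exists_exchange`).

Two facts about `g` are used. It is order-indiscernible over its base
(`RealizesPower.realize_iff_of_order_iff`), because membership in the invariant extension of `p`
depends only on the type over `A` of the parameters. And each formula `φ(x; y)` has a number `m`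
such that for all parameters fewer than `m` terms satisfy it or fewer than `m` do not
(`IsGenericallyStableOver.exists_bound`): by saturation `M` contains a Morley sequence over a small
set witnessing generic stability, and `g` is conjugate to it by strong homogeneity.

For the exchange property take `N = 2 * m`, with `m` the bound for `H`. Among `N + 1` subgroups one
is redundant, since otherwise a product of witnesses would lie in `m` of them and outside `m`
others (`exists_iInf_le_of_alternation_bound`). So the inclusion of an intersection of `N`
subgroups in another one holds for one position of the index of the latter among those of the
former. By order-indiscernibility the truth of this inclusion depends only on the position, and it
is a first-order condition on that index. Spreading the `N` indices apart leaves many indices at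
each position, so the bound for this condition excludes that it holds at one position and fails at
another (`exchangeLE_of_isExchange`).

The first chain condition is the exchange property for tuples of length one, with the elements of
`A` and of `c` as parameters. For the second, given a set `S` of `k * N` indices, the entries of an
arbitrary increasing tuple are exchanged from right to left for indices above `S`, and those in turn
from left to right for indices in consecutive blocks of `S` (`mem_of_forall_mem_finset`). All tuples
that occur are increasing.
-/

namespace StableChain

/-! ### Redundant subgroups and exchange of indices -/

theorem le_encard_of_injective {α : Type*} {m : ℕ} {P : α → Prop} (f : Fin m → α)
    (hf : Function.Injective f) (h : ∀ i, P (f i)) : (m : ℕ∞) ≤ {a | P a}.encard := by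
  have := Set.encard_le_encard (s := Set.range f) (t := {a | P a})
    (by rintro _ ⟨i, rfl⟩; exact h i)
  rwa [← Set.image_univ, hf.encard_image, Set.encard_univ, ENat.card_eq_coe_fintype_card,
    Fintype.card_fin] at this

/-- If no membership pattern `{i | b ∈ F i}` has `m` indices inside and `m` outside, one of
`2 * m + 1` subgroups contains the intersection of the others. Otherwise for each `v` some
element lies in all the others but not in `F v`, and products of such elements realize every
pattern. -/
theorem exists_iInf_le_of_alternation_bound {Γ : Type*} [Group Γ] {m : ℕ}
    (F : Fin (2 * m + 1) → Subgroup Γ)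
    (hF : ∀ b, ({i | b ∈ F i}.encard < m ∨ {i | b ∉ F i}.encard < m)) :
    ∃ v, ∀ b, (∀ i ≠ v, b ∈ F i) → b ∈ F v := by
  by_contra! hcon
  choose x hx hxv using hcon
  -- a product of the witnesses with index in a list lies in `F i` iff `i` is not in the list
  have key : ∀ l : List (Fin (2 * m + 1)), l.Nodup → ∀ i,
      ((l.map x).prod ∈ F i ↔ i ∉ l) := by
    intro l
    induction l with
    | nil => intro _ i; simp [(F i).one_mem]
    | cons a l ih =>
      intro hl i
      rw [List.nodup_cons] at hl
      rw [List.map_cons, List.prod_cons, List.mem_cons, not_or, ← ih hl.2 i]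
      by_cases hia : i = a
      · subst hia
        have := (ih hl.2 i).2 hl.1
        simp [(F i).mul_mem_cancel_right this, hxv]
      · simp [hia, (F i).mul_mem_cancel_left (hx a i hia)]
  classical
  let s : Finset (Fin (2 * m + 1)) := Finset.univ.filter (fun i => i.val < m)
  have hs := key s.toList s.nodup_toList
  have hs1 : {i | (s.toList.map x).prod ∈ F i} = {i : Fin (2 * m + 1) | m ≤ i.val} := by
    ext i; simp [hs, s]
  have hs2 : {i | (s.toList.map x).prod ∉ F i} = {i : Fin (2 * m + 1) | i.val < m} := by
    ext i; simp [hs, s]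
  have low : (m : ℕ∞) ≤ {i : Fin (2 * m + 1) | i.val < m}.encard :=
    le_encard_of_injective (fun i : Fin m => ⟨i, by omega⟩)
      (fun a b h => by simpa [Fin.ext_iff] using h) fun i => i.2
  have high : (m : ℕ∞) ≤ {i : Fin (2 * m + 1) | m ≤ i.val}.encard :=
    le_encard_of_injective (fun i : Fin m => ⟨m + i, by omega⟩)
      (fun a b h => by simpa [Fin.ext_iff] using h) fun i => Nat.le_add_right _ _
  rcases hF (s.toList.map x).prod with h | h
  · rw [hs1] at h; exact absurd high (not_le.2 h)
  · rw [hs2] at h; exact absurd low (not_le.2 h)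

/-- The strictly increasing sequence `w` consists of possible values for the entry `s` of the
increasing tuple `t`, other than `t s`, and its terms smaller than `t s` are the first `q` ones.
For given `s` and `q` this fixes the order type of `(t, w)`. -/
structure IsExchange {k N : ℕ} (s : Fin k) (q : ℕ) (t : Fin k → ℕ) (w : Fin N → ℕ) : Prop where
  tuple : StrictMono t
  values : StrictMono w
  update : ∀ r, StrictMono (Function.update t s (w r))
  lt_iff : ∀ r, w r < t s ↔ r.val < q
  ne : ∀ r, w r ≠ t s

/-- The subgroup at `t` contains the intersection of the subgroups at the tuples obtained from `t`
by replacing the entry `s` by the values of `w`. -/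
def ExchangeLE {Γ : Type*} [Group Γ] {k N : ℕ} (K : (Fin k → ℕ) → Subgroup Γ) (s : Fin k)
    (t : Fin k → ℕ) (w : Fin N → ℕ) : Prop :=
  ∀ b, (∀ r, b ∈ K (Function.update t s (w r))) → b ∈ K t

/-- A tuple with entry `s + x` at `s`, which is increasing for all `x < T`: the other entries leave
room for `T` values of this one. -/
def spreadTuple {k : ℕ} (s : Fin k) (T x : ℕ) : Fin k → ℕ :=
  fun i => if i < s then i else if i = s then s + x else s + T + i

theorem spreadTuple_self {k : ℕ} (s : Fin k) (T x : ℕ) : spreadTuple s T x s = s + x := by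
  simp [spreadTuple]

theorem update_spreadTuple {k : ℕ} (s : Fin k) (T x y : ℕ) :
    Function.update (spreadTuple s T x) s (s + y) = spreadTuple s T y := by
  ext i
  by_cases h : i = s
  · subst h; simp [spreadTuple]
  · simp [spreadTuple, h]

theorem strictMono_spreadTuple {k : ℕ} (s : Fin k) {T x : ℕ} (hx : x < T) :
    StrictMono (spreadTuple s T x) := by
  intro i j hij
  simp only [spreadTuple, Fin.lt_def, Fin.ext_iff] at *
  split_ifs <;> omega

theorem isExchange_spreadTuple {k N : ℕ} (s : Fin k) {q T x : ℕ} {w : Fin N → ℕ} (hx : x < T)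
    (hw : StrictMono w) (hwT : ∀ r, w r < T) (hq : ∀ r, w r < x ↔ r.val < q)
    (hne : ∀ r, w r ≠ x) : IsExchange s q (spreadTuple s T x) (fun r => s + w r) where
  tuple := strictMono_spreadTuple s hx
  values := fun a b hab => Nat.add_lt_add_left (hw hab) _
  update := fun r => by
    rw [update_spreadTuple]; exact strictMono_spreadTuple s (hwT r)
  lt_iff := fun r => by rw [spreadTuple_self, ← hq r]; omega
  ne := fun r => by rw [spreadTuple_self]; have := hne r; omega

theorem IsExchange.order_iff {k N q : ℕ} {s : Fin k} {t t' : Fin k → ℕ} {w w' : Fin N → ℕ}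
    (h : IsExchange s q t w) (h' : IsExchange s q t' w') (x y : Fin k ⊕ Fin N) :
    Sum.elim t w x < Sum.elim t w y → Sum.elim t' w' x < Sum.elim t' w' y := by
  have below {t : Fin k → ℕ} {w : Fin N → ℕ} (h : IsExchange s q t w) (a : Fin k) (r : Fin N)
      (ha : a < s) : t a < w r := by
    simpa [ha.ne] using h.update r ha
  have above {t : Fin k → ℕ} {w : Fin N → ℕ} (h : IsExchange s q t w) (a : Fin k) (r : Fin N)
      (ha : s < a) : w r < t a := by
    simpa [ha.ne'] using h.update r ha
  rcases x with a | r <;> rcases y with b | r' <;> simp only [Sum.elim_inl, Sum.elim_inr]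
  · exact fun hab => h'.tuple (h.tuple.lt_iff_lt.1 hab)
  · intro hlt
    rcases lt_trichotomy a s with ha | rfl | ha
    · exact below h' a r' ha
    · exact lt_of_le_of_ne (not_lt.1 (fun hc =>
        absurd ((h.lt_iff r').2 ((h'.lt_iff r').1 hc)) (not_lt.2 hlt.le))) (h'.ne r').symm
    · exact absurd (above h a r' ha) (not_lt.2 hlt.le)
  · intro hlt
    rcases lt_trichotomy b s with hb | rfl | hb
    · exact absurd (below h b r hb) (not_lt.2 hlt.le)
    · exact (h'.lt_iff r).2 ((h.lt_iff r).1 hlt)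
    · exact above h' b r hb
  · exact fun hrr' => h'.values (h.values.lt_iff_lt.1 hrr')

theorem IsExchange.injective {k N q : ℕ} {s : Fin k} {t : Fin k → ℕ} {w : Fin N → ℕ}
    (h : IsExchange s q t w) : Function.Injective (Sum.elim t w) := by
  refine h.tuple.injective.sumElim h.values.injective fun a r har => ?_
  by_cases ha : a = s
  · exact h.ne r (ha ▸ har.symm)
  · refine ha ((h.update r).injective ?_)
    simp [ha, har]

/-- **Exchange.** Whether `ExchangeLE K s t w` holds depends only on the number `q` of terms of `w`
below `t s`. It holds for some `q` because one of `2 * m + 1` subgroups is redundant, and it does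
not change with `q` because the bound `m'` allows no change of truth value between two gaps of
`w` that both contain `m'` indices. -/
theorem exchangeLE_of_isExchange {Γ : Type*} [Group Γ] {k m : ℕ} (K : (Fin k → ℕ) → Subgroup Γ)
    (s : Fin k)
    (hK : ∀ t b, {l | b ∈ K (Function.update t s l)}.encard < m ∨
      {l | b ∉ K (Function.update t s l)}.encard < m)
    (hD : ∃ m' : ℕ, ∀ t (w : Fin (2 * m) → ℕ),
      {l | ExchangeLE K s (Function.update t s l) w}.encard < m' ∨
      {l | ¬ ExchangeLE K s (Function.update t s l) w}.encard < m')
    (hord : ∀ q t t' (w w' : Fin (2 * m) → ℕ), IsExchange s q t w → IsExchange s q t' w' →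
      ExchangeLE K s t w → ExchangeLE K s t' w')
    {q : ℕ} {t : Fin k → ℕ} {w : Fin (2 * m) → ℕ} (h : IsExchange s q t w) :
    ExchangeLE K s t w := by
  obtain ⟨m', hm'⟩ := hD
  -- replacing `q` by `min q (2 * m)` describes the same configuration
  wlog hq : q ≤ 2 * m generalizing q
  · exact this (q := 2 * m)
      { h with lt_iff := fun r => by rw [h.lt_iff]; have := r.2; omega } le_rfl
  obtain ⟨v, hv⟩ := exists_iInf_le_of_alternation_bound
    (fun i : Fin (2 * m + 1) => K (spreadTuple s (2 * m + 1) i)) (m := m) (by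
      intro b
      have hinj : Function.Injective (fun i : Fin (2 * m + 1) => s.val + i.val) :=
        fun a b h => by simpa [Fin.ext_iff] using h
      refine (hK (spreadTuple s (2 * m + 1) 0) b).imp (fun h => lt_of_le_of_lt ?_ h)
        (fun h => lt_of_le_of_lt ?_ h)
      all_goals
        rw [← hinj.encard_image]
        apply Set.encard_le_encard
        rintro _ ⟨i, hi, rfl⟩
        simpa [update_spreadTuple] using hi)
  have hred : ExchangeLE K s (spreadTuple s (2 * m + 1) v)
      (fun r : Fin (2 * m) => s + (v.succAbove r).val) := by
    intro b hb
    refine hv b fun i hi => ?_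
    obtain ⟨r, rfl⟩ := Fin.exists_succAbove_eq hi
    simpa [update_spreadTuple] using hb r
  have hredx : IsExchange s v (spreadTuple s (2 * m + 1) v)
      (fun r : Fin (2 * m) => s + (v.succAbove r).val) := by
    refine isExchange_spreadTuple s v.2 (fun a b hab => ?_) (fun r => (v.succAbove r).2)
      (fun r => ?_) (fun r h => ?_)
    · exact (Fin.strictMono_succAbove v) hab
    · rw [← Fin.lt_def, Fin.succAbove_lt_iff_castSucc_lt, Fin.lt_def]; rfl
    · exact Fin.succAbove_ne v r (Fin.ext h)
  by_contra hcon
  -- `w₀` has `m'` indices in each of its gaps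
  set T := (m' + 1) * (2 * m + 1) + 1 with hT
  let w₀ : Fin (2 * m) → ℕ := fun r => (m' + 1) * (r + 1)
  have gap : ∀ q' ≤ 2 * m, ∀ e : Fin m', IsExchange s q'
      (spreadTuple s T ((m' + 1) * q' + 1 + e)) (fun r => s + w₀ r) := by
    intro q' hq' e
    have he := e.2
    have lt_of (a b : ℕ) (hab : a < b) : (m' + 1) * a + (m' + 1) ≤ (m' + 1) * b := by
      have := Nat.mul_le_mul_left (m' + 1) hab
      rwa [Nat.succ_eq_add_one, Nat.mul_add, Nat.mul_one] at this
    refine isExchange_spreadTuple s ?_ (fun a b hab => ?_) (fun r => ?_) (fun r => ?_)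
      (fun r => ?_)
    · have := lt_of q' (2 * m + 1) (by omega); omega
    · have := lt_of (a + 1) (b + 1) (by simpa using hab)
      simp only [w₀]; omega
    · have := lt_of (r + 1) (2 * m + 1) (by have := r.2; omega)
      simp only [w₀]; omega
    · simp only [w₀]
      constructor
      · intro h
        by_contra hr
        have := lt_of q' (r + 1) (by omega); omega
      · intro hr
        have := Nat.mul_le_mul_left (m' + 1) (Nat.succ_le_of_lt hr)
        rw [Nat.succ_eq_add_one] at this; omega
    · simp only [w₀]
      rcases Nat.lt_or_ge q' (r + 1) with h | h
      · have := lt_of q' (r + 1) h; omega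
      · have := Nat.mul_le_mul_left (m' + 1) h; omega
  have inj (q' : ℕ) : Function.Injective
      (fun e : Fin m' => s.val + ((m' + 1) * q' + 1 + e.val)) :=
    fun a b h => by simpa [Fin.ext_iff] using h
  rcases hm' (spreadTuple s T 0) (fun r => s + w₀ r) with hlt | hlt
  · refine absurd hlt (not_lt.2 (le_encard_of_injective _ (inj v) fun e => ?_))
    rw [update_spreadTuple]
    exact hord v _ _ _ _ hredx (gap v (by omega) e) hred
  · refine absurd hlt (not_lt.2 (le_encard_of_injective _ (inj q) fun e => ?_))
    rw [update_spreadTuple]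
    exact fun h' => hcon (hord q _ _ _ _ (gap q hq e) h h')

/-- The exchange property without the restriction that the values differ from `t s`. -/
theorem mem_of_forall_mem_update {Γ : Type*} [Group Γ] {k N : ℕ} (K : (Fin k → ℕ) → Subgroup Γ)
    (s : Fin k)
    (hex : ∀ q t (w : Fin N → ℕ), IsExchange s q t w → ExchangeLE K s t w)
    {t : Fin k → ℕ} (ht : StrictMono t) {w : Fin N → ℕ} (hw : StrictMono w)
    (hup : ∀ r, StrictMono (Function.update t s (w r))) {b : Γ}
    (hb : ∀ r, b ∈ K (Function.update t s (w r))) : b ∈ K t := by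
  by_cases hne : ∃ r, w r = t s
  · obtain ⟨r, hr⟩ := hne
    simpa [hr] using hb r
  · push Not at hne
    obtain ⟨q, hq⟩ : ∃ q : ℕ, ∀ r, w r < t s ↔ r.val < q := by
      classical
      by_cases h : ∃ n : ℕ, ∃ hn : n < N, t s ≤ w ⟨n, hn⟩
      · refine ⟨Nat.find h, fun r => ?_⟩
        obtain ⟨hn, hle⟩ := Nat.find_spec h
        constructor
        · intro hr
          by_contra hlt
          exact absurd (hle.trans (hw.monotone (Fin.le_def.2 (not_lt.1 hlt)))) (not_le.2 hr)
        · intro hr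
          have := Nat.find_min h hr
          push Not at this
          exact this r.2
      · push Not at h
        exact ⟨N, fun r => ⟨fun _ => r.2, fun _ => h r r.2⟩⟩
    exact hex q t w ⟨ht, hw, hup, hq, hne⟩ b hb

/-- The chain condition for increasing tuples follows from exchange in each entry: every subgroup
`K t` contains the intersection of the `K i` for `i` in a set of `k * N` indices. -/
theorem mem_of_forall_mem_finset {Γ : Type*} [Group Γ] {k N : ℕ} (K : (Fin k → ℕ) → Subgroup Γ)
    (hex : ∀ s, ∀ t, StrictMono t → ∀ w : Fin N → ℕ, StrictMono w →
      (∀ r, StrictMono (Function.update t s (w r))) → ExchangeLE K s t w)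
    (S : Finset ℕ) (hS : S.card = k * N) (b : Γ)
    (hb : ∀ i : Fin k → ℕ, StrictMono i → (∀ l, i l ∈ S) → b ∈ K i)
    (t : Fin k → ℕ) (ht : StrictMono t) : b ∈ K t := by
  have hlt (a : Fin k) (r : Fin N) : a.val * N + r.val < k * N := by
    have h := Nat.mul_le_mul_right N (Nat.succ_le_of_lt a.2)
    have := r.2
    rw [Nat.succ_mul] at h; omega
  let e := S.orderEmbOfFin hS
  let blk : Fin k → Fin N → ℕ := fun a r => e ⟨a * N + r, hlt a r⟩
  have hblkS (a r) : blk a r ∈ S := S.orderEmbOfFin_mem hS _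
  have hblk_mono (a) : StrictMono (blk a) := fun r r' h => e.strictMono
    (Nat.add_lt_add_left h (a.val * N))
  have hblk_lt (a a' r r') (h : a < a') : blk a r < blk a' r' := e.strictMono (by
    have h1 := Nat.mul_le_mul_right N (Nat.succ_le_of_lt (Fin.lt_def.1 h))
    have := r.2
    rw [Nat.succ_mul] at h1
    simp only [Fin.lt_def]; omega)
  -- tuples whose first `k - d` entries lie in consecutive blocks of `S` and whose other
  -- entries are above `S`: the entries are replaced from left to right
  have above : ∀ d ≤ k, ∀ t : Fin k → ℕ, StrictMono t →
      (∀ a, a.val < k - d → ∃ r, t a = blk a r) →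
      (∀ a, k - d ≤ a.val → ∀ x ∈ S, x < t a) → b ∈ K t := by
    intro d
    induction d with
    | zero =>
      intro _ t ht h1 _
      refine hb t ht fun l => ?_
      obtain ⟨r, hr⟩ := h1 l (by simp)
      exact hr ▸ hblkS l r
    | succ d ih =>
      intro hd t ht h1 h2
      let s : Fin k := ⟨k - (d + 1), by omega⟩
      have hsv : s.val = k - (d + 1) := rfl
      have hup (r : Fin N) : StrictMono (Function.update t s (blk s r)) := by
        intro a a' haa'
        by_cases ha : a = s
        · have ha' : a' ≠ s := fun h => by subst h; exact absurd haa' (by simp [ha])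
          rw [ha, Function.update_self, Function.update_of_ne ha']
          exact h2 a' (by have := Fin.lt_def.1 haa'; rw [ha] at this; omega) _ (hblkS _ _)
        · rw [Function.update_of_ne ha]
          by_cases ha' : a' = s
          · rw [ha', Function.update_self]
            have hlt' : a < s := ha' ▸ haa'
            obtain ⟨r', hr'⟩ := h1 a (by have := Fin.lt_def.1 hlt'; omega)
            rw [hr']
            exact hblk_lt _ _ _ _ hlt'
          · rw [Function.update_of_ne ha']
            exact ht haa'
      refine hex s t ht (blk s) (hblk_mono s) hup b fun r => ih (by omega) _ (hup r) ?_ ?_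
      · intro a ha
        by_cases has : a = s
        · exact ⟨r, by simp [has]⟩
        · rw [Function.update_of_ne has]
          exact h1 a (by have : a.val ≠ s.val := fun h => has (Fin.ext h)
                         omega)
      · intro a ha
        rw [Function.update_of_ne (fun h => by subst h; omega)]
        exact h2 a (by omega)
  obtain ⟨B, hB⟩ : ∃ B, ∀ x ∈ S, x < B := ⟨S.sup id + 1, fun x hx =>
    Nat.lt_succ_of_le (Finset.le_sup (f := id) hx)⟩
  -- tuples whose entries with index at least `d` are large: the entries are replaced from
  -- right to left, by values that leave room for further replacements
  have far : ∀ d ≤ k, ∀ t : Fin k → ℕ, StrictMono t →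
      (∀ a, d ≤ a.val → B + (N + 1) * a.val ≤ t a) → b ∈ K t := by
    intro d
    induction d with
    | zero =>
      intro _ t ht h
      refine above k le_rfl t ht (fun a ha => by omega) fun a _ x hx => ?_
      have := h a (Nat.zero_le _)
      have := hB x hx
      omega
    | succ d ih =>
      intro hd t ht h
      let s : Fin k := ⟨d, hd⟩
      by_cases hts : B + (N + 1) * d ≤ t s
      · refine ih (by omega) t ht fun a ha => ?_
        rcases ha.eq_or_lt with h' | h'
        · have : a = s := Fin.ext h'.symm
          rw [this]; exact hts
        · exact h a h'
      · have hup (r : Fin N) : StrictMono (Function.update t s (B + (N + 1) * d + r)) := by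
          intro a a' haa'
          by_cases ha : a = s
          · have ha' : a' ≠ s := fun h => by subst h; exact absurd haa' (by simp [ha])
            rw [ha, Function.update_self, Function.update_of_ne ha']
            have h3 : d + 1 ≤ a'.val := by have := Fin.lt_def.1 haa'; rw [ha] at this; exact this
            have h4 := h a' h3
            have h5 := Nat.mul_le_mul_left (N + 1) h3
            have := r.2
            rw [Nat.mul_add] at h5; omega
          · rw [Function.update_of_ne ha]
            by_cases ha' : a' = s
            · rw [ha', Function.update_self]
              have := ht (ha' ▸ haa' : a < s)
              omega
            · rw [Function.update_of_ne ha']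
              exact ht haa'
        refine hex s t ht (fun r => B + (N + 1) * d + r)
          (fun r r' hrr' => by simpa using hrr') hup b fun r => ih (by omega) _ (hup r) ?_
        intro a ha
        by_cases has : a = s
        · rw [has, Function.update_self]
          exact Nat.le_add_right _ _
        · rw [Function.update_of_ne has]
          exact h a (by have : a.val ≠ s.val := fun h => has (Fin.ext h)
                        have : s.val = d := rfl
                        omega)
  exact far k le_rfl t ht fun a ha => absurd a.2 (by omega)

/-! ### Formulas, homogeneity and realizations of types -/

section ModelTheory

variable {L : FirstOrder.Language.{u, v}}

/-- A formula mentions only finitely many of its parameters. -/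
theorem exists_finite_params {α γ : Type*} (φ : L.Formula (α ⊕ γ)) :
    ∃ (n : ℕ) (ψ : L.Formula (α ⊕ Fin n)) (e : Fin n → γ),
      ∀ (N : Type w) [L.Structure N] (v : α → N) (b : γ → N),
        φ.Realize (Sum.elim v b) ↔ ψ.Realize (Sum.elim v (b ∘ e)) := by
  classical
  let S : Finset γ := φ.freeVarFinset.preimage Sum.inr Sum.inr_injective.injOn
  let f : φ.freeVarFinset → α ⊕ Fin S.card := fun x => match x with
    | ⟨Sum.inl a, _⟩ => Sum.inl a
    | ⟨Sum.inr c, h⟩ => Sum.inr (S.equivFin ⟨c, by simpa [S] using h⟩)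
  refine ⟨S.card, φ.restrictFreeVar f, fun i => (S.equivFin.symm i).1, fun N _ v b => ?_⟩
  refine (BoundedFormula.realize_restrictFreeVar (Sum.elim v b) ?_).symm
  rintro ⟨a | c, h⟩
  · rfl
  · simp [f]

/-- Equality of types over `A`, with formulas over `A` replaced by formulas without constants
evaluated at the elements of `A`. -/
theorem sameType_iff {M : Type w} [L.Structure M] {ι : Type*} {A : Set M} {s t : ι → M} :
    SameType (L := L) A s t ↔ ∀ φ : L.Formula (A ⊕ ι),
      φ.Realize (Sum.elim (fun a : A => (a : M)) s) ↔
        φ.Realize (Sum.elim (fun a : A => (a : M)) t) := by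
  have key (φ : L[[A]].Formula ι) (r : ι → M) :
      Formula.Realize (BoundedFormula.constantsVarsEquiv φ : L.Formula (A ⊕ ι))
        (Sum.elim (fun a : A => (a : M)) r) ↔ φ.Realize r :=
    BoundedFormula.realize_constantsVarsEquiv (L := L) (M := M) (φ := φ) (v := r) (xs := default)
  refine ⟨fun h φ => ?_, fun h φ => ?_⟩
  · obtain ⟨ψ, rfl⟩ :=
      (BoundedFormula.constantsVarsEquiv (L := L) (γ := A) (α := ι) (n := 0)).surjective φ
    exact (key ψ s).trans ((h ψ).trans (key ψ t).symm)
  · exact (key φ s).symm.trans ((h _).trans (key φ t))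

/-- In a strongly homogeneous model, small tuples with the same type are conjugate. -/
theorem IsStronglyHomogeneous.exists_equiv {M : Type w} [L.Structure M] {κ : Cardinal.{w}}
    (hM : IsStronglyHomogeneous L M κ) {ι : Type*} (s t : ι → M)
    (hs : Cardinal.mk (Set.range s) < κ)
    (hst : ∀ φ : L.Formula ι, φ.Realize s ↔ φ.Realize t) :
    ∃ σ : M ≃[L] M, ∀ i, σ (s i) = t i := by
  choose pre hpre using fun b : Set.range s => b.2
  have hreal (φ : L.Formula (Set.range s)) (r : ι → M) :
      (φ.relabel pre).Realize r ↔ φ.Realize (r ∘ pre) := Formula.realize_relabel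
  obtain ⟨σ, hσ⟩ := hM _ hs (t ∘ pre) (fun φ => by
    rw [← hreal φ t, ← hst, hreal φ s]
    exact iff_of_eq (congrArg φ.Realize (funext fun b => (hpre b).symm)))
  refine ⟨σ, fun i => ?_⟩
  have heq := (hst ((Term.var (pre ⟨s i, i, rfl⟩)).equal (Term.var i))).1 (by
    simp only [Formula.realize_equal, Term.realize_var]
    exact hpre ⟨s i, i, rfl⟩)
  simp only [Formula.realize_equal, Term.realize_var] at heq
  exact (hσ ⟨s i, i, rfl⟩).trans heq

/-- A global type is the type of an element of an elementary extension. -/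
theorem GlobalType.exists_realization {M : Type w} [L.Structure M] [Nonempty M]
    (p : GlobalType L M) :
    ∃ (N : Type (max u v w)) (_ : L[[M]].Structure N) (_ : Nonempty N)
      (_ : N ⊨ L.elementaryDiagram M) (e : N),
      ∀ φ : L[[M]].Formula (Fin 1), Formula.equivSentence φ ∈ p ↔ φ.Realize (fun _ => e) := by
  obtain ⟨N, e, he⟩ := Theory.exists_modelType_is_realized_in _ p
  refine ⟨N, inferInstance, inferInstance, inferInstance, e 0, fun φ => ?_⟩
  rw [← he, Theory.CompleteType.formula_mem_typeOf]
  exact iff_of_eq (congrArg φ.Realize (funext fun i => by rw [Subsingleton.elim i 0]))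

/-- Substituting constants for parameters is evaluation at their interpretations. -/
theorem realize_subst_con {γ N : Type*} [L.Structure N] [L[[γ]].Structure N]
    [(L.lhomWithConstants γ).IsExpansionOn N] {n : ℕ} (φ : L.Formula (Fin 1 ⊕ Fin n))
    (c : Fin n → γ) (v : Fin 1 → N) :
    Formula.Realize (((L.lhomWithConstants γ).onFormula φ).subst
      (Sum.elim (fun i => Term.var i) (fun j => (L.con (c j)).term)) : L[[γ]].Formula (Fin 1)) v ↔
    φ.Realize (Sum.elim v (fun j => (L.con (c j) : N))) := by
  refine BoundedFormula.realize_subst.trans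
    ((LHom.realize_onFormula (L.lhomWithConstants γ) φ).trans ?_)
  refine iff_of_eq (congrArg φ.Realize (funext fun x => ?_))
  rcases x with i | j
  · rfl
  · exact Term.realize_constants

/-- In a saturated model the restriction of a global type to a small set is realized. -/
theorem IsSaturated.exists_realize {M : Type w} [L.Structure M] [Nonempty M] {κ : Cardinal.{w}}
    (hM : IsSaturated L M κ) (p : GlobalType L M) (C : Set M) (hC : Cardinal.mk C < κ) :
    ∃ a : M, ∀ n, ∀ φ : L.Formula (Fin 1 ⊕ Fin n), ∀ c : Fin n → M, (∀ k, c k ∈ C) →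
      (formulasOf p n φ c ↔ φ.Realize (Sum.elim (fun _ => a) c)) := by
  obtain ⟨N, _, _, hN, e, he⟩ := p.exists_realization
  let F : L[[C]] →ᴸ L[[M]] := L.lhomWithConstantsMap ((↑) : C → M)
  let _ : L[[C]].Structure N := F.reduct N
  let _ : L.Structure N := (L.lhomWithConstants M).reduct N
  have _ : F.IsExpansionOn N := LHom.isExpansionOn_reduct F N
  have _ : (LHom.constantsOnMap ((↑) : C → M)).IsExpansionOn M := constantsOnMap_isExpansionOn rfl
  have _ : F.IsExpansionOn M := LHom.sumMap_isExpansionOn _ _ _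
  have _ : (L.lhomWithConstants M).IsExpansionOn N := LHom.isExpansionOn_reduct _ N
  have _ : (L.lhomWithConstants C).IsExpansionOn N := ⟨fun _ _ => rfl, fun _ _ => rfl⟩
  have hNC : N ⊨ L[[C]].completeTheory M := by
    refine ⟨fun ψ hψ => ?_⟩
    rw [← LHom.realize_onSentence N F ψ]
    refine hN.realize_of_mem _ ?_
    rw [mem_completeTheory] at hψ ⊢
    exact (LHom.realize_onSentence M F ψ).2 hψ
  obtain ⟨a, ha⟩ := hM C hC ((L[[C]].completeTheory M).typeOf (fun _ : Fin 1 => e))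
  refine ⟨a 0, fun n φ c hc => ?_⟩
  have h := SetLike.ext_iff.1 ha (Formula.equivSentence
    (((L.lhomWithConstants C).onFormula φ).subst
      (Sum.elim (fun i => Term.var i) (fun j => (L.con (⟨c j, hc j⟩ : C)).term))))
  rw [Theory.CompleteType.formula_mem_typeOf, Theory.CompleteType.formula_mem_typeOf,
    realize_subst_con, realize_subst_con] at h
  refine (he _).trans ((realize_subst_con φ c _).trans (h.symm.trans ?_))
  refine iff_of_eq (congrArg φ.Realize (congrArg₂ Sum.elim (funext fun i => ?_) rfl))
  rw [Subsingleton.elim i 0]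

/-! ### Morley sequences -/

/-- Over a small set there are Morley sequences in `M` itself. -/
theorem IsSaturated.exists_isMorleySeq {M : Type w} [L.Structure M] [Nonempty M]
    {κ : Cardinal.{w}} (hκ : Cardinal.aleph0 ≤ κ) (hM : IsSaturated L M κ) (p : GlobalType L M)
    (C : Set M) (hC : Cardinal.mk C < κ) : ∃ a : ℕ → M, IsMorleySeq (formulasOf p) C a := by
  have small (l : List M) : Cardinal.mk ↑(C ∪ {x | x ∈ l}) < κ :=
    (Cardinal.mk_union_le _ _).trans_lt (Cardinal.add_lt_of_lt hκ hC
      ((Cardinal.lt_aleph0_iff_set_finite.2 l.finite_toSet).trans_le hκ))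
  choose pick hpick using fun l : List M => hM.exists_realize p _ (small l)
  -- the terms of the sequence with index less than `n`
  let prev : ℕ → List M := fun n => n.rec [] (fun _ l => pick l :: l)
  have hprev : ∀ n, ∀ m < n, pick (prev m) ∈ prev n := by
    intro n
    induction n with
    | zero => intro m hm; omega
    | succ n ih =>
      intro m hm
      rcases Nat.lt_succ_iff_lt_or_eq.1 hm with h | rfl
      · exact List.mem_cons_of_mem _ (ih m h)
      · exact List.mem_cons_self
  refine ⟨fun n => pick (prev n), fun i n φ c hc => hpick (prev i) n φ c fun k => ?_⟩
  rcases hc k with h | ⟨m, hm, h⟩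
  · exact Or.inl h
  · exact Or.inr (h ▸ hprev i m hm)

/-- Reads the last variable of a tuple as the distinguished variable. -/
def lastVar {k : ℕ} {γ : Type*} : Fin (k + 1) ⊕ γ → Fin 1 ⊕ (Fin k ⊕ γ) :=
  Sum.elim (Fin.lastCases (Sum.inl 0) (fun a => Sum.inr (Sum.inl a))) (fun c => Sum.inr (Sum.inr c))

theorem elim_comp_lastVar {N : Type*} {k : ℕ} {γ : Type*} (v : Fin (k + 1) → N) (c : γ → N) :
    Sum.elim (fun _ => v (Fin.last k)) (Sum.elim (fun a => v a.castSucc) c) ∘ lastVar =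
      Sum.elim v c := by
  funext x
  rcases x with x | x
  · induction x using Fin.lastCases <;> simp [lastVar]
  · rfl

section Extension

variable {M N : Type w} [L.Structure M] [L.Structure N] {p : GlobalType L M} {A : Set M}
  {j : M ↪ₑ[L] N} {h : ℕ → N}

/-- A Morley sequence over `M` is order-indiscernible over `M`: by induction on the length, the type
over `A` of the parameters determines which formulas belong to the invariant extension. -/
theorem IsMorleySeq.realize_iff_of_strictMono
    (hh : IsMorleySeq (extension p A j) (Set.range j) h) {k : ℕ} :
    ∀ {γ : Type w} (φ : L.Formula (Fin k ⊕ γ)) (c : γ → M) (i i' : Fin k → ℕ), StrictMono i →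
      StrictMono i' →
      (φ.Realize (Sum.elim (h ∘ i) (j ∘ c)) ↔ φ.Realize (Sum.elim (h ∘ i') (j ∘ c))) := by
  induction k with
  | zero => intro γ φ c i i' _ _; rw [Subsingleton.elim i i']
  | succ k ih =>
    intro γ φ c i i' hi hi'
    obtain ⟨n, ψ, e, hψ⟩ := exists_finite_params.{u, v, w} (φ.relabel lastVar)
    let d (i : Fin (k + 1) → ℕ) : Fin n → N :=
      Sum.elim (fun a : Fin k => (h ∘ i) a.castSucc) (j ∘ c) ∘ e
    have hred (i : Fin (k + 1) → ℕ) (hi : StrictMono i) :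
        φ.Realize (Sum.elim (h ∘ i) (j ∘ c)) ↔ extension p A j n ψ (d i) := by
      have hd (x : Fin n) : d i x ∈ Set.range j ∪ h '' Set.Iio (i (Fin.last k)) := by
        simp only [d, Function.comp_apply]
        rcases e x with a | a
        · exact Or.inr ⟨_, hi (Fin.castSucc_lt_last a), rfl⟩
        · exact Or.inl ⟨_, rfl⟩
      rw [hh (i (Fin.last k)) n ψ (d i) hd, ← hψ N, Formula.realize_relabel,
        ← elim_comp_lastVar (h ∘ i) (j ∘ c)]
      rfl
    have hsame : SameType (L := L) (j '' A) (d i) (d i') := by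
      rw [sameType_iff]
      intro χ
      choose pre hpre using fun a : j '' A => a.2
      let f : ↑(j '' A) ⊕ Fin n → Fin k ⊕ (γ ⊕ ↑(j '' A)) :=
        Sum.elim (fun a => Sum.inr (Sum.inr a)) (Sum.map id Sum.inl ∘ e)
      have hf (i : Fin (k + 1) → ℕ) : Sum.elim (fun a : j '' A => (a : N)) (d i) =
          Sum.elim (h ∘ (i ∘ Fin.castSucc)) (j ∘ Sum.elim c pre) ∘ f := by
        funext x
        rcases x with a | x
        · exact (hpre a).2.symm
        · simp only [d, f, Function.comp_apply, Sum.elim_inr]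
          rcases e x with a | a <;> rfl
      rw [hf i, hf i', ← Formula.realize_relabel, ← Formula.realize_relabel]
      exact ih _ _ _ _ (hi.comp (Fin.strictMono_castSucc)) (hi'.comp (Fin.strictMono_castSucc))
    rw [hred i hi, hred i' hi']
    constructor
    · rintro ⟨c', hc', hp⟩
      exact ⟨c', fun χ => (hc' χ).trans (hsame χ), hp⟩
    · rintro ⟨c', hc', hp⟩
      exact ⟨c', fun χ => (hc' χ).trans (hsame χ).symm, hp⟩

/-- A Morley sequence over `M` and a Morley sequence over `A` have the same type over `A`. The
truth of `φ(x; d)` in the extension does not depend on the tuple of `M` that witnesses it, because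
two such tuples are conjugate over `A`. -/
theorem IsMorleySeq.realize_iff_of_isMorleySeq {κ : Cardinal.{w}} (hκ : Cardinal.aleph0 ≤ κ)
    (hM : IsStronglyHomogeneous L M κ) (hA : Cardinal.mk A < κ) (hp : IsInvariant p A)
    (hh : IsMorleySeq (extension p A j) (Set.range j) h) {a : ℕ → M}
    (ha : IsMorleySeq (formulasOf p) A a) {k : ℕ} :
    ∀ {γ : Type w} (φ : L.Formula (Fin k ⊕ γ)) (c : γ → M), (∀ x, c x ∈ A) →
      (φ.Realize (Sum.elim (fun i : Fin k => h i) (j ∘ c)) ↔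
        φ.Realize (Sum.elim (fun i : Fin k => a i) c)) := by
  induction k with
  | zero =>
    intro γ φ c _
    rw [← j.map_formula]
    refine iff_of_eq (congrArg φ.Realize (funext fun x => ?_))
    rcases x with x | x
    · exact x.elim0
    · rfl
  | succ k ih =>
    intro γ φ c hc
    obtain ⟨n, ψ, e, hψ⟩ := exists_finite_params.{u, v, w} (φ.relabel lastVar)
    let d : Fin n → N := Sum.elim (fun x : Fin k => h x) (j ∘ c) ∘ e
    let d' : Fin n → M := Sum.elim (fun x : Fin k => a x) c ∘ e
    have hd (x : Fin n) : d x ∈ Set.range j ∪ h '' Set.Iio k := by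
      simp only [d, Function.comp_apply]
      rcases e x with a | a
      · exact Or.inr ⟨_, a.2, rfl⟩
      · exact Or.inl ⟨_, rfl⟩
    have hd' (x : Fin n) : d' x ∈ A ∪ a '' Set.Iio k := by
      simp only [d', Function.comp_apply]
      rcases e x with a | a
      · exact Or.inr ⟨_, a.2, rfl⟩
      · exact Or.inl (hc a)
    have hsame (χ : L.Formula (↑(j '' A) ⊕ Fin n)) :
        χ.Realize (Sum.elim (fun a : j '' A => (a : N)) (j ∘ d')) ↔
          χ.Realize (Sum.elim (fun a : j '' A => (a : N)) d) := by
      choose pre hpre using fun a : j '' A => a.2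
      let f : ↑(j '' A) ⊕ Fin n → Fin k ⊕ (γ ⊕ ↑(j '' A)) :=
        Sum.elim (fun a => Sum.inr (Sum.inr a)) (Sum.map id Sum.inl ∘ e)
      have h1 := ih (χ.relabel f) (Sum.elim c pre) (by
        rintro (x | x)
        · exact hc x
        · exact (hpre x).1)
      rw [Formula.realize_relabel, Formula.realize_relabel, ← j.map_formula] at h1
      refine Iff.trans ?_ (h1.symm.trans ?_)
      all_goals
        refine iff_of_eq (congrArg χ.Realize (funext fun x => ?_))
        rcases x with x | x
      · exact (hpre x).2.symm
      · simp only [d', f, Function.comp_apply, Sum.elim_inr]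
        rcases e x with x | x <;> rfl
      · exact (hpre x).2
      · simp only [d, f, Function.comp_apply, Sum.elim_inr]
        rcases e x with x | x <;> rfl
    have hext : extension p A j n ψ d ↔ formulasOf p n ψ d' := by
      constructor
      · rintro ⟨c', hc', hp'⟩
        rw [sameType_iff] at hc'
        have hconj (χ : L.Formula (A ⊕ Fin n)) :
            χ.Realize (Sum.elim (fun a : A => (a : M)) c') ↔
              χ.Realize (Sum.elim (fun a : A => (a : M)) d') := by
          let f : A ⊕ Fin n → ↑(j '' A) ⊕ Fin n :=
            Sum.map (fun a => ⟨j a, a, a.2, rfl⟩) id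
          have h1 := (hc' (χ.relabel f)).trans (hsame (χ.relabel f)).symm
          rw [Formula.realize_relabel, Formula.realize_relabel] at h1
          rw [← j.map_formula, ← j.map_formula]
          convert h1 using 2 <;> (funext x; rcases x with x | x <;> rfl)
        obtain ⟨σ, hσ⟩ := hM.exists_equiv _ _ (by
          rw [Set.Sum.elim_range]
          refine (Cardinal.mk_union_le _ _).trans_lt (Cardinal.add_lt_of_lt hκ ?_ ?_)
          · rwa [Subtype.range_coe]
          · exact (Cardinal.lt_aleph0_iff_set_finite.2 (Set.finite_range c')).trans_le hκ) hconj
        have h2 := (hp σ (fun x hx => hσ (Sum.inl ⟨x, hx⟩)) n ψ c').1 hp'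
        convert h2 using 1
        exact funext fun x => (hσ (Sum.inr x)).symm
      · exact fun h' => ⟨d', sameType_iff.2 hsame, h'⟩
    rw [hh k n ψ d hd, ha k n ψ d' hd', ← hψ N, ← hψ M, Formula.realize_relabel,
      Formula.realize_relabel] at hext
    have e1 := elim_comp_lastVar (fun x : Fin (k + 1) => h x) (j ∘ c)
    have e2 := elim_comp_lastVar (fun x : Fin (k + 1) => a x) c
    rw [← e1, ← e2]
    exact hext

end Extension

variable {M : Type w} [L.Structure M] {p : GlobalType L M} {A B : Set M} {g : ℕ → M}

/-- A realization of `p^(ω)` over `B` is order-indiscernible over `B`. -/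
theorem RealizesPower.realize_iff_of_order_iff (hg : RealizesPower p A B g) {τ : Type} [Finite τ]
    {γ : Type w} (φ : L.Formula (τ ⊕ γ)) (c : γ → M) (hc : ∀ x, c x ∈ B) (i i' : τ → ℕ)
    (hi : Function.Injective i) (hii' : ∀ x y, i x < i y → i' x < i' y) :
    φ.Realize (Sum.elim (g ∘ i) c) ↔ φ.Realize (Sum.elim (g ∘ i') c) := by
  obtain ⟨N, _, j, h, hh, hgh⟩ := hg
  rw [sameType_iff] at hgh
  have transfer (i : τ → ℕ) :
      φ.Realize (Sum.elim (g ∘ i) c) ↔ φ.Realize (Sum.elim (h ∘ i) (j ∘ c)) := by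
    let f : τ ⊕ γ → ↑(j '' B) ⊕ ℕ :=
      Sum.elim (fun x => Sum.inr (i x)) (fun x => Sum.inl ⟨j (c x), c x, hc x, rfl⟩)
    have h1 := hgh (φ.relabel f)
    rw [Formula.realize_relabel, Formula.realize_relabel] at h1
    rw [← j.map_formula]
    convert h1 using 2 <;> (funext x; rcases x with x | x <;> rfl)
  have _ := Fintype.ofFinite τ
  -- an enumeration of the variables in increasing order of the indices
  let e₀ := (Fintype.equivFin τ).symm
  let e : Fin (Fintype.card τ) ≃ τ := (Tuple.sort (i ∘ e₀)).trans e₀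
  have he : StrictMono (i ∘ e) :=
    (Tuple.monotone_sort (i ∘ e₀)).strictMono_of_injective (hi.comp e.injective)
  have he' : StrictMono (i' ∘ e) := fun x y hxy => hii' _ _ (he hxy)
  have sorted (i : τ → ℕ) : φ.Realize (Sum.elim (h ∘ i) (j ∘ c)) ↔
      (φ.relabel (Sum.map e.symm id)).Realize (Sum.elim (h ∘ (i ∘ e)) (j ∘ c)) := by
    rw [Formula.realize_relabel]
    refine iff_of_eq (congrArg φ.Realize (funext fun x => ?_))
    rcases x with x | x
    · simp
    · rfl
  rw [transfer, transfer, sorted, sorted]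
  exact hh.realize_iff_of_strictMono _ _ _ _ he he'

/-- Every realization of `p^(ω)` over some set is conjugate to every Morley sequence over `A`. -/
theorem RealizesPower.exists_equiv {κ : Cardinal.{w}} (hκ : Cardinal.aleph0 < κ)
    (hM : IsStronglyHomogeneous L M κ) (hA : Cardinal.mk A < κ) (hp : IsInvariant p A)
    (hg : RealizesPower p A B g) {a : ℕ → M}
    (ha : IsMorleySeq (formulasOf p) A a) :
    ∃ σ : M ≃[L] M, ∀ i, σ (a i) = g i := by
  obtain ⟨N, _, j, h, hh, hgh⟩ := hg
  rw [sameType_iff] at hgh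
  refine hM.exists_equiv a g
    (lt_of_le_of_lt (Cardinal.le_aleph0_iff_set_countable.2 (Set.countable_range a)) hκ) fun φ => ?_
  obtain ⟨n, ψ, e, hψ⟩ := exists_finite_params.{u, v, w}
    (φ.relabel (Sum.inr : ℕ → PEmpty.{w + 1} ⊕ ℕ))
  obtain ⟨k, hk⟩ : ∃ k, ∀ x, e x < k := ⟨Finset.univ.sup e + 1, fun x =>
    Nat.lt_succ_of_le (Finset.le_sup (Finset.mem_univ x))⟩
  have bounded {K : Type w} [L.Structure K] (r : ℕ → K) (z : PEmpty → K) : φ.Realize r ↔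
      (ψ.relabel (Sum.elim PEmpty.elim (fun x => Sum.inl (⟨e x, hk x⟩ : Fin k)) :
        _ → Fin k ⊕ PEmpty.{w + 1})).Realize (Sum.elim (fun i : Fin k => r i) z) := by
    have h1 := hψ K z r
    rw [Formula.realize_relabel] at h1
    rw [Formula.realize_relabel]
    refine h1.trans (iff_of_eq (congrArg ψ.Realize (funext fun x => ?_)))
    rcases x with x | x
    · exact x.elim
    · rfl
  have h1 := hgh (φ.relabel Sum.inr)
  rw [Formula.realize_relabel, Formula.realize_relabel] at h1
  have h2 : φ.Realize g ↔ φ.Realize h := by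
    rw [← j.map_formula]
    exact h1
  rw [h2, bounded a PEmpty.elim, bounded h (j ∘ PEmpty.elim)]
  exact (hh.realize_iff_of_isMorleySeq hκ.le hM hA hp ha _ _ (fun x => x.elim)).symm

end ModelTheory

/-! ### Exchange for realizations of the power of a generically stable type -/

section Exchange

variable {L : FirstOrder.Language.{u, v}}

/-- The inclusion of the intersection of the fibers of `H` at the tuples obtained from `t` by
replacing the entry `s` by the entries of `w` in the fiber at `t`, as a formula in `(t, w)`. -/
noncomputable def exchangeFormula {M : Type w} [L.Structure M] (G : DefinableGroup L M)
    {β : Type w} {k N : ℕ} (s : Fin k)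
    (H : L.Formula (Fin 1 ⊕ (β ⊕ Fin k))) : L.Formula ((Fin k ⊕ Fin N) ⊕ β) :=
  Formula.iAlls (β := Fin 1)
    ((G.formula.relabel Sum.inr).imp
      ((Formula.iInf fun r : Fin N => H.relabel (Sum.elim Sum.inr (Sum.elim
        (fun x => Sum.inl (Sum.inr x))
        (fun a => Sum.inl (Sum.inl (Function.update Sum.inl s (Sum.inr r) a)))))).imp
        (H.relabel (Sum.elim Sum.inr (Sum.elim
          (fun x => Sum.inl (Sum.inr x)) (fun a => Sum.inl (Sum.inl (Sum.inl a))))))))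

theorem realize_exchangeFormula {M : Type w} [L.Structure M] (G : DefinableGroup L M)
    {β : Type w} {k N : ℕ} (s : Fin k)
    (H : L.Formula (Fin 1 ⊕ (β ⊕ Fin k))) (t : Fin k → M) (w : Fin N → M) (d : β → M) :
    (exchangeFormula G s H).Realize (Sum.elim (Sum.elim t w) d) ↔
      ∀ x : G.Carrier,
        (∀ r, H.Realize (Sum.elim (fun _ => (x : M)) (Sum.elim d (Function.update t s (w r))))) →
        H.Realize (Sum.elim (fun _ => (x : M)) (Sum.elim d t)) := by
  have h1 (x : Fin 1 → M) (r : Fin N) :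
      Sum.elim (Sum.elim (Sum.elim t w) d) x ∘ Sum.elim Sum.inr (Sum.elim
        (fun x => Sum.inl (Sum.inr x))
        (fun a => Sum.inl (Sum.inl (Function.update Sum.inl s (Sum.inr r) a)))) =
      Sum.elim (fun _ => x 0) (Sum.elim d (Function.update t s (w r))) := by
    funext y
    rcases y with y | y | y
    · simp [Subsingleton.elim y 0]
    · rfl
    · by_cases hy : y = s
      · subst hy; simp
      · simp [hy]
  have h2 (x : Fin 1 → M) :
      Sum.elim (Sum.elim (Sum.elim t w) d) x ∘ Sum.elim Sum.inr (Sum.elim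
        (fun x => Sum.inl (Sum.inr x)) (fun a => Sum.inl (Sum.inl (Sum.inl a)))) =
      Sum.elim (fun _ => x 0) (Sum.elim d t) := by
    funext y
    rcases y with y | y | y
    · simp [Subsingleton.elim y 0]
    · rfl
    · rfl
  have h3 (x : Fin 1 → M) : x = fun _ => x 0 := funext fun i => by rw [Subsingleton.elim i 0]
  simp only [exchangeFormula, Formula.realize_iAlls, Formula.realize_imp, Formula.realize_iInf,
    Formula.realize_relabel]
  constructor
  · intro h x
    have := h (fun _ => x)
    simp only [h1, h2] at this
    exact this x.2
  · intro h x hx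
    simp only [h1, h2]
    refine h ⟨x 0, ?_⟩
    rw [Sum.elim_comp_inr, h3 x] at hx
    exact hx

section GenericallyStable

variable {M : Type w} [L.Structure M] [Nonempty M] {κ : Cardinal.{w}} {p : GlobalType L M}
  {A : Set M}

/-- The bound in generic stability, with respect to Morley sequences over an unspecified small set,
holds with the same number `m` for all realizations of `p^(ω)`, as these are conjugate to such
sequences. -/
theorem IsGenericallyStableOver.exists_bound (hM : IsMonster L M κ) (hA : Cardinal.mk A < κ)
    (hp : IsGenericallyStableOver κ p A) {γ : Type w} (φ : L.Formula (Fin 1 ⊕ γ)) :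
    ∃ m : ℕ, ∀ (B : Set M) (g : ℕ → M), RealizesPower p A B g → ∀ b : γ → M,
      {i | φ.Realize (Sum.elim (fun _ => g i) b)}.encard < m ∨
      {i | ¬ φ.Realize (Sum.elim (fun _ => g i) b)}.encard < m := by
  obtain ⟨hinv, A', hA', -, hbd⟩ := hp
  obtain ⟨n, ψ, e, hψ⟩ := exists_finite_params.{u, v, w} φ
  obtain ⟨m, hm⟩ := hbd n ψ
  obtain ⟨a, ha⟩ := hM.saturated.exists_isMorleySeq hM.aleph0_lt.le p (A ∪ A')
    ((Cardinal.mk_union_le _ _).trans_lt (Cardinal.add_lt_of_lt hM.aleph0_lt.le hA hA'))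
  have mono {C : Set M} (hC : C ⊆ A ∪ A') : IsMorleySeq (formulasOf p) C a :=
    fun i n φ c hc => ha i n φ c fun k => Set.union_subset_union_left _ hC (hc k)
  refine ⟨m, fun B g hg b => ?_⟩
  obtain ⟨σ, hσ⟩ := hg.exists_equiv hM.aleph0_lt hM.homogeneous hA hinv
    (mono Set.subset_union_left)
  have key (i : ℕ) : φ.Realize (Sum.elim (fun _ => g i) b) ↔
      ψ.Realize (Sum.elim (fun _ => a i) (fun x => σ.symm (b (e x)))) := by
    rw [hψ M, ← StrongHomClass.realize_formula σ ψ (v := Sum.elim (fun _ => a i) _)]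
    refine iff_of_eq (congrArg ψ.Realize (funext fun x => ?_))
    rcases x with x | x
    · exact (hσ i).symm
    · simp
  simp only [key]
  exact hm a (mono Set.subset_union_right) _

/-- The terms of a realization of `p^(ω)` lie in `G` when `p` contains the formula of `G`. -/
theorem RealizesPower.realize_group {B : Set M} {g : ℕ → M} (hM : IsMonster L M κ)
    (hA : Cardinal.mk A < κ) (hinv : IsInvariant p A) {G : DefinableGroup L M}
    (hpG : G.MemType p) (hg : RealizesPower p A B g) (i : ℕ) :
    G.formula.Realize (fun _ => g i) := by
  obtain ⟨a, ha⟩ := hM.saturated.exists_isMorleySeq hM.aleph0_lt.le p A hA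
  obtain ⟨σ, hσ⟩ := hg.exists_equiv hM.aleph0_lt hM.homogeneous hA hinv ha
  have hmem : formulasOf p 0 (G.formula.relabel Sum.inl) Fin.elim0 := by
    obtain ⟨N, _, _, hN, e, he⟩ := p.exists_realization
    let _ : L.Structure N := (L.lhomWithConstants M).reduct N
    have _ : (L.lhomWithConstants M).IsExpansionOn N := LHom.isExpansionOn_reduct _ N
    refine (he _).2 ((realize_subst_con _ _ _).2 (Formula.realize_relabel.2 ?_))
    exact (LHom.realize_onFormula (L.lhomWithConstants M) G.formula).1 ((he _).1 hpG)
  have h := Formula.realize_relabel.1 ((ha i 0 _ _ (fun k => k.elim0)).1 hmem)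
  rw [Sum.elim_comp_inl, ← StrongHomClass.realize_formula σ] at h
  convert h using 1
  exact funext fun _ => (hσ i).symm

/-- The exchange property for the subgroups defined by a formula at increasing tuples of a
realization of `p^(ω)`, with a number `N` that depends on the formula only. -/
theorem IsGenericallyStableOver.exists_exchange (hM : IsMonster L M κ) (hA : Cardinal.mk A < κ)
    (hp : IsGenericallyStableOver κ p A) (G : DefinableGroup L M) {β : Type w} {k : ℕ}
    (H : L.Formula (Fin 1 ⊕ (β ⊕ Fin k))) (s : Fin k) :
    ∃ N : ℕ, ∀ (B : Set M) (g : ℕ → M), RealizesPower p A B g → ∀ d : β → M, (∀ x, d x ∈ B) →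
      ∀ K : (Fin k → ℕ) → Subgroup G.Carrier,
      (∀ t x, x ∈ K t ↔ H.Realize (Sum.elim (fun _ => (x : M)) (Sum.elim d (g ∘ t)))) →
      ∀ t, StrictMono t → ∀ w : Fin N → ℕ, StrictMono w →
        (∀ r, StrictMono (Function.update t s (w r))) → ExchangeLE K s t w := by
  -- `H` with the entry `s` of the tuple as the distinguished variable
  let f : Fin 1 ⊕ (β ⊕ Fin k) → Fin 1 ⊕ (Fin 1 ⊕ (β ⊕ Fin k)) :=
    Sum.elim (fun x => Sum.inr (Sum.inl x)) (Sum.elim (fun x => Sum.inr (Sum.inr (Sum.inl x)))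
      (Function.update (fun a => Sum.inr (Sum.inr (Sum.inr a))) s (Sum.inl 0)))
  obtain ⟨m, hm⟩ := hp.exists_bound hM hA (H.relabel f)
  -- `exchangeFormula` with the entry `s` of the tuple as the distinguished variable
  let f' : (Fin k ⊕ Fin (2 * m)) ⊕ β → Fin 1 ⊕ (β ⊕ (Fin k ⊕ Fin (2 * m))) :=
    Sum.elim (Sum.elim
      (Function.update (fun a => Sum.inr (Sum.inr (Sum.inl a))) s (Sum.inl 0))
      (fun r => Sum.inr (Sum.inr (Sum.inr r)))) (fun x => Sum.inr (Sum.inl x))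
  obtain ⟨m', hm'⟩ := hp.exists_bound hM hA ((exchangeFormula (N := 2 * m) G s H).relabel f')
  refine ⟨2 * m, fun B g hg d hd K hK t ht w hw hup b hb => ?_⟩
  have comp_update (t : Fin k → ℕ) (l : ℕ) :
      g ∘ Function.update t s l = Function.update (g ∘ t) s (g l) := Function.comp_update _ _ _ _
  have hex (t : Fin k → ℕ) (w : Fin (2 * m) → ℕ) : ExchangeLE K s t w ↔
      (exchangeFormula G s H).Realize (Sum.elim (g ∘ Sum.elim t w) d) := by
    rw [Sum.comp_elim, realize_exchangeFormula]
    simp only [ExchangeLE, hK, comp_update, Function.comp_apply]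
  refine mem_of_forall_mem_update K s (fun q t w h => ?_) ht hw hup hb
  refine exchangeLE_of_isExchange (m := m) K s (fun t b => ?_) ⟨m', fun t w => ?_⟩
    (fun q t t' w w' h h' => ?_) h
  · have h1 := hm B g hg (Sum.elim (fun _ => (b : M)) (Sum.elim d (g ∘ t)))
    have h2 (l : ℕ) : b ∈ K (Function.update t s l) ↔ (H.relabel f).Realize
        (Sum.elim (fun _ => g l) (Sum.elim (fun _ => (b : M)) (Sum.elim d (g ∘ t)))) := by
      rw [hK, Formula.realize_relabel]
      refine iff_of_eq (congrArg H.Realize (funext fun x => ?_))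
      rcases x with x | x | a
      · rfl
      · rfl
      · by_cases ha : a = s
        · subst ha; simp [f]
        · simp [f, ha]
    simpa only [h2] using h1
  · have h1 := hm' B g hg (Sum.elim d (Sum.elim (g ∘ t) (g ∘ w)))
    have h2 (l : ℕ) : ExchangeLE K s (Function.update t s l) w ↔
        ((exchangeFormula G s H).relabel f').Realize
        (Sum.elim (fun _ => g l) (Sum.elim d (Sum.elim (g ∘ t) (g ∘ w)))) := by
      rw [hex, Formula.realize_relabel]
      refine iff_of_eq (congrArg _ (funext fun x => ?_))
      rcases x with (a | r) | x
      · by_cases ha : a = s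
        · subst ha
          simp only [f', Function.comp_apply, Sum.elim_inl, Function.update_self]
        · simp only [f', Function.comp_apply, Sum.elim_inl, Function.update_of_ne ha,
            Sum.elim_inr]
      · rfl
      · rfl
    simpa only [h2] using h1
  · rw [hex, hex]
    exact (hg.realize_iff_of_order_iff _ d hd _ _ h.injective (h.order_iff h')).1

end GenericallyStable

end Exchange

end StableChain

/-! ### The chain conditions -/

theorem mainTheorem4 {L : FirstOrder.Language.{u, v}} {M : Type w} [L.Structure M] [Nonempty M]
    (κ : Cardinal.{w}) (hM : StableChain.IsMonster L M κ)
    (G : StableChain.DefinableGroup L M) (A : Set M) (hA : Cardinal.mk A < κ)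
    (p : StableChain.GlobalType L M) (hpG : G.MemType p)
    (hp : StableChain.IsGenericallyStableOver κ p A) :
    (∀ (k : ℕ) (H : L[[A]].Formula (Fin 1 ⊕ (Fin k ⊕ Fin 1))), G.DefinesSubgroups H →
      ∃ n : ℕ, ∀ (c : Fin k → G.Carrier) (g : ℕ → M),
        StableChain.RealizesPower p A (A ∪ Set.range (fun l => (c l : M))) g →
        ∀ i : Fin n → ℕ, StrictMono i →
          (⋂ j : ℕ, G.fiber H (Sum.elim (fun l => (c l : M)) (fun _ => g j))) =
            ⋂ r : Fin n, G.fiber H (Sum.elim (fun l => (c l : M)) (fun _ => g (i r)))) ∧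
    (∀ (k : ℕ) (H : L[[A]].Formula (Fin 1 ⊕ Fin k)), G.DefinesSubgroups H →
      ∀ g : ℕ → M, StableChain.RealizesPower p A A g →
        ∃ n : ℕ,
          (⋂ (i : Fin k → ℕ) (_ : StrictMono i), G.fiber H (fun l => g (i l))) =
            (⋂ (i : Fin k → ℕ) (_ : StrictMono i ∧ ∀ l, i l < n), G.fiber H (fun l => g (i l))) ∧
          ∀ S : Finset ℕ, S.card = n →
            (⋂ (i : Fin k → ℕ) (_ : StrictMono i), G.fiber H (fun l => g (i l))) =
              ⋂ (i : Fin k → ℕ) (_ : StrictMono i ∧ ∀ l, i l ∈ S),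
                G.fiber H (fun l => g (i l))) := by
  -- the formula `H` over `A`, with the elements of `A` as values of further variables
  have unfold {ι : Type} (H : L[[A]].Formula ι) (r : ι → M) :
      Formula.Realize (BoundedFormula.constantsVarsEquiv H : L.Formula (A ⊕ ι))
        (Sum.elim (fun a : A => (a : M)) r) ↔ H.Realize r :=
    BoundedFormula.realize_constantsVarsEquiv (L := L) (M := M) (φ := H) (v := r) (xs := default)
  have hgG {B : Set M} {g : ℕ → M} (hg : StableChain.RealizesPower p A B g) (i : ℕ) :=
    hg.realize_group hM hA hp.1 hpG i
  constructor
  -- the case of tuples of length one, with `A` and `c` as parameters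
  · intro k H hH
    let f : A ⊕ (Fin 1 ⊕ (Fin k ⊕ Fin 1)) → Fin 1 ⊕ ((A ⊕ Fin k) ⊕ Fin 1) :=
      Sum.elim (fun a => Sum.inr (Sum.inl (Sum.inl a))) (Sum.map id (Sum.map Sum.inr id))
    let H' : L.Formula (A ⊕ (Fin 1 ⊕ (Fin k ⊕ Fin 1))) := BoundedFormula.constantsVarsEquiv H
    obtain ⟨n, hn⟩ := hp.exists_exchange hM hA G (H'.relabel f) 0
    refine ⟨n, fun c g hg i hi => Set.Subset.antisymm (fun x hx => ?_) (fun x hx => ?_)⟩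
    · exact Set.mem_iInter.2 fun r => Set.mem_iInter.1 hx (i r)
    choose K hK using fun t : Fin 1 → ℕ =>
      hH (Sum.elim c (fun _ => ⟨g (t 0), hgG hg (t 0)⟩))
    have hmem (t : Fin 1 → ℕ) (x : G.Carrier) :
        x ∈ K t ↔ x ∈ G.fiber H (Sum.elim (fun l => (c l : M)) (fun _ => g (t 0))) := by
      rw [← SetLike.mem_coe, hK]
      refine iff_of_eq (congrArg (x ∈ G.fiber H ·) (funext fun y => ?_))
      rcases y with y | y <;> rfl
    refine Set.mem_iInter.2 fun j => (hmem (fun _ => j) x).1 (hn _ g hg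
      (Sum.elim (fun a : A => (a : M)) (fun l => c l)) ?_ K (fun t x => ?_)
      (fun _ => j) (Subsingleton.strictMono _) i hi (fun _ => Subsingleton.strictMono _) x
      fun r => (hmem _ x).2 ?_)
    · rintro (a | l)
      · exact Or.inl a.2
      · exact Or.inr ⟨l, rfl⟩
    · rw [hmem, Formula.realize_relabel]
      refine (unfold H _).symm.trans (iff_of_eq (congrArg H'.Realize (funext fun y => ?_)))
      rcases y with y | y | y | y
      · rfl
      · rfl
      · rfl
      · simp [f, Subsingleton.elim y 0]
    · simpa using Set.mem_iInter.1 hx r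
  · intro k H hH g hg
    let f : A ⊕ (Fin 1 ⊕ Fin k) → Fin 1 ⊕ (A ⊕ Fin k) :=
      Sum.elim (fun a => Sum.inr (Sum.inl a)) (Sum.map id Sum.inr)
    let H' : L.Formula (A ⊕ (Fin 1 ⊕ Fin k)) := BoundedFormula.constantsVarsEquiv H
    choose n hn using hp.exists_exchange hM hA G (H'.relabel f)
    choose K hK using fun t : Fin k → ℕ => hH (fun l => ⟨g (t l), hgG hg (t l)⟩)
    have hmem (t : Fin k → ℕ) (x : G.Carrier) :
        x ∈ K t ↔ x ∈ G.fiber H (fun l => g (t l)) := by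
      rw [← SetLike.mem_coe, hK]
    have hKH (t : Fin k → ℕ) (x : G.Carrier) : x ∈ K t ↔
        (H'.relabel f).Realize
          (Sum.elim (fun _ => (x : M)) (Sum.elim (fun a : A => (a : M)) (g ∘ t))) := by
      rw [hmem, Formula.realize_relabel]
      refine (unfold H _).symm.trans (iff_of_eq (congrArg H'.Realize (funext fun y => ?_)))
      rcases y with y | y | y <;> rfl
    have hle (s : Fin k) : n s ≤ Finset.univ.sup n := Finset.le_sup (Finset.mem_univ s)
    have main (S : Finset ℕ) (hS : S.card = k * Finset.univ.sup n) :
        (⋂ (i : Fin k → ℕ) (_ : StrictMono i), G.fiber H (fun l => g (i l))) =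
          ⋂ (i : Fin k → ℕ) (_ : StrictMono i ∧ ∀ l, i l ∈ S),
            G.fiber H (fun l => g (i l)) := by
      refine Set.Subset.antisymm (fun x hx => ?_) (fun x hx => ?_)
      · exact Set.mem_iInter₂.2 fun i hi => Set.mem_iInter₂.1 hx i hi.1
      · refine Set.mem_iInter₂.2 fun t ht => (hmem t x).1
          (StableChain.mem_of_forall_mem_finset K (fun s t ht w hw hup b hb => ?_) S hS x
            (fun i hi hiS => (hmem i x).2 (Set.mem_iInter₂.1 hx i ⟨hi, hiS⟩)) t ht)
        exact hn s A g hg _ (fun a => a.2) K hKH t ht (w ∘ Fin.castLE (hle s))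
          (hw.comp (Fin.strictMono_castLE _)) (fun r => hup _) b (fun r => hb _)
    refine ⟨k * Finset.univ.sup n, ?_, main⟩
    have := main (Finset.range (k * Finset.univ.sup n)) (Finset.card_range _)
    simpa only [Finset.mem_range] using this
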